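/- Let $L$ be a countable first-order language and let $\mathcal M$ be a (nonempty) $L$-structure with universe $M$. Suppose that $\mathcal M$ is $\omega$-categorical (that is, the complete theory of $\mathcal M$ is $\aleph_0$-categorical) and that algebraic closure in $\mathcal M$ is degenerate, that is, $\operatorname{acl}_{\mathcal M}(A)=A$ for every $A\subseteq M$. Suppose moreover that for every $0<n<\omega$ and every complete $n$-type $p$ over $\emptyset$ of the theory of $\mathcal M$, with set of realizations $X=\{\bar a\in M^n : \mathcal M\models p(\bar a)\}$, the following condition holds: $(*)$ if $\bar a',\bar a^*,\bar b^*,\bar c^*,\bar d^*$ are finite tuples of elements of $M$ whose ranges are mutually disjoint, where the starred tuples are nonempty (but $\bar a'$ may be empty), and $\bar a'\bar a^*,\ \bar a'\bar b^*,\ \bar a'\bar c^*,\ \bar a'\bar d^*\in X$, then there is a tuple $\bar e^*$ of elements of $M$ such that $$\operatorname{tp}_{\mathcal M}(\bar e^*,\bar a^*,\bar a')=\operatorname{tp}_{\mathcal M}(\bar c^*,\bar a^*,\bar a')\quad\text{and}\quad \operatorname{tp}_{\mathcal M}(\bar e^*,\bar b^*,\bar a')=\operatorname{tp}_{\mathcal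 M}(\bar d^*,\bar b^*,\bar a').$$ Then for every $A\subseteq M$, $\operatorname{acl}_{\mathcal M^{\mathrm{eq}}}(A)=\operatorname{dcl}_{\mathcal M^{\mathrm{eq}}}(A)$. Here $\mathcal M^{\mathrm{eq}}$ is the extension of $\mathcal M$ by imaginaries: its elements are the classes of the equivalence relations on $M^n$ ($n<\omega$) that are definable in $\mathcal M$ without parameters, and $M$ is identified with the sort of equality on $M^1$. An element is in $\operatorname{acl}(A)$ (respectively $\operatorname{dcl}(A)$) if it belongs to a finite set definable with parameters from $A$ (respectively, if its singleton is definable with parameters from $A$). -/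

import Mathlib

open FirstOrder FirstOrder.Language Set

universe u v w

namespace ImaginaryClosure

/-! ### Algebraic and definable closure in an arbitrary first-order structure -/

section Closure

variable (L : FirstOrder.Language.{u, v}) {N : Type w} [L.Structure N]

/-- The algebraic closure of `A`: the elements lying in some finite subset of the universe that is
definable by a first-order formula with parameters from `A`. -/
def acl (A : Set N) : Set N :=
  {b | ∃ D : Set N, A.Definable₁ L D ∧ D.Finite ∧ b ∈ D}

/-- The definable closure of `A`: the elements `b` such that `{b}` is definable by a first-order
formula with parameters from `A`. -/
def dcl (A : Set N) : Set N :=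
  {b | A.Definable₁ L {b}}

variable (N) in
/-- Algebraic closure is degenerate: every set is algebraically closed. -/
def DegenerateAcl : Prop :=
  ∀ A : Set N, acl L A = A

variable (N) in
/-- The structure is `ω`-categorical: its complete theory is `ℵ₀`-categorical. -/
def OmegaCategorical : Prop :=
  Cardinal.Categorical (Cardinal.aleph0.{w}) (L.completeTheory N)

end Closure

/-! ### The structure of imaginary elements -/

section Imaginaries

variable (L : FirstOrder.Language.{u, v}) (M : Type w) [L.Structure M]

/-- The sorts of imaginaries: equivalence relations on a finite power of `M` which are
definable without parameters. -/
structure EqSort where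
  /-- the length of the tuples -/
  arity : ℕ
  /-- the equivalence relation on tuples -/
  rel : Setoid (Fin arity → M)
  /-- as a set of pairs of tuples, the relation is definable without parameters -/
  definable : (∅ : Set M).Definable L
    {x : Fin arity ⊕ Fin arity → M | rel.r (fun i => x (Sum.inl i)) (fun i => x (Sum.inr i))}

/-- The universe of `M^eq`: the disjoint union, over all sorts, of the sets of classes. -/
def Meq : Type w := Σ E : EqSort L M, Quotient E.rel

/-- The home sort: equality on `1`-tuples. -/
def homeSort : EqSort L M where
  arity := 1
  rel := ⊥
  definable := by
    refine ⟨Term.equal (var (Sum.inl 0)) (var (Sum.inr 0)), ?_⟩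
    ext x
    simp only [Set.mem_ofPred_eq, Formula.realize_equal, Term.realize_var]
    constructor
    · intro h
      exact congrFun h 0
    · intro h
      show (fun i => x (Sum.inl i)) = (fun i => x (Sum.inr i))
      funext i
      rw [Subsingleton.elim i 0]
      exact h

variable {L M}

/-- The class of a tuple, as an element of `M^eq`. -/
def Meq.cls (E : EqSort L M) (a : Fin E.arity → M) : Meq L M := ⟨E, Quotient.mk E.rel a⟩

variable (L) in
/-- The usual identification of the elements of `M` with the elements of the home sort. -/
def Meq.real (a : M) : Meq L M := Meq.cls (homeSort L M) (fun _ => a)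

variable (L M)

/-- The relation symbols of the language of `M^eq`: those of `L` (function symbols being replaced
by symbols for their graphs), a unary symbol for each sort, and a symbol for the graph of the
projection from tuples of `M` onto each sort. -/
inductive EqRelations : ℕ → Type (max u v w)
  | graph {n : ℕ} (f : L.Functions n) : EqRelations (n + 1)
  | rel {n : ℕ} (R : L.Relations n) : EqRelations n
  | sort (E : EqSort L M) : EqRelations 1
  | proj (E : EqSort L M) : EqRelations (E.arity + 1)

/-- The language of `M^eq`; it is relational. -/
def Leq : FirstOrder.Language.{0, max u v w} :=
  ⟨fun _ => Empty, EqRelations L M⟩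

/-- The interpretation of the relation symbols of the language of `M^eq`. -/
def eqRelMap : {n : ℕ} → EqRelations L M n → (Fin n → Meq L M) → Prop
  | _, .graph f, x => ∃ a : _ → M,
      x = Fin.snoc (α := fun _ => Meq L M) (fun i => Meq.real L (a i))
        (Meq.real L (Structure.funMap f a))
  | _, .rel R, x => ∃ a : _ → M, (x = fun i => Meq.real L (a i)) ∧ Structure.RelMap R a
  | _, .sort E, x => ∃ a : Fin E.arity → M, x 0 = Meq.cls E a
  | _, .proj E, x => ∃ a : Fin E.arity → M,
      x = Fin.snoc (α := fun _ => Meq L M) (fun i => Meq.real L (a i)) (Meq.cls E a)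

/-- The first-order structure `M^eq`. -/
instance Meq.structure : (Leq L M).Structure (Meq L M) where
  funMap := fun f _ => f.elim
  RelMap := fun R x => eqRelMap L M R x

end Imaginaries

/-! ### Complete types over the empty set and the amalgamation condition -/

section Star

variable (L : FirstOrder.Language.{u, v}) {M : Type w} [L.Structure M] [Nonempty M]

/-- The complete type over the empty set, in `M`, of a tuple of elements of `M` indexed by `α`. -/
def tp {α : Type} (a : α → M) : (L.completeTheory M).CompleteType α :=
  (L.completeTheory M).typeOf a

/-- The set of realizations in `M` of a complete type over the empty set. -/
def realizations {α : Type} (p : (L.completeTheory M).CompleteType α) : Set (α → M) :=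
  {a | tp L a = p}

/-- The concatenation of a `k`-tuple and an `m`-tuple, as an `n`-tuple, where `k + m = n`. -/
def concat {k m n : ℕ} (h : k + m = n) (a' : Fin k → M) (a : Fin m → M) : Fin n → M :=
  fun i => Fin.append a' a (Fin.cast h.symm i)

/-- Condition `(*)` for a complete `n`-type `p` over the empty set. The type of a triple of tuples
`(x, y, z)` is the type of the tuple indexed by the disjoint union of the index sets. -/
def StarCondition {n : ℕ} (p : (L.completeTheory M).CompleteType (Fin n)) : Prop :=
  ∀ (k m : ℕ) (h : k + m = n), 0 < m →
    ∀ (a' : Fin k → M) (a b c d : Fin m → M),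
      [range a', range a, range b, range c, range d].Pairwise Disjoint →
      concat h a' a ∈ realizations L p → concat h a' b ∈ realizations L p →
      concat h a' c ∈ realizations L p → concat h a' d ∈ realizations L p →
      ∃ e : Fin m → M,
        tp L (Sum.elim e (Sum.elim a a')) = tp L (Sum.elim c (Sum.elim a a')) ∧
        tp L (Sum.elim e (Sum.elim b a')) = tp L (Sum.elim d (Sum.elim b a'))

end Star

end ImaginaryClosure

/-! The heart is a pigeonhole argument. Let `a` be a finite tuple, and let `F` be a map given by a
sort `E` (with entries of `a` allowed in the representatives) that sends the realizations of
`tp(b/a)`, for `b` disjoint from `a`, into a finite set. Degenerate algebraic closure yields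
realizations avoiding any finite set, so one value `C` of `F` is attained by realizations avoiding
any finite set. If some realization `d` had `F d ≠ C`, pick disjoint `x₁, x₂, x₃` with value `C`.
Condition `(*)` gives `e` that looks like `x₃` over `x₁ a`, so `F e = C`, and like `d` over `x₂ a`,
so `F e ≠ C`. Hence `F` is constant (`rel_of_starCondition`); entries of `b` lying in `a` are fixed
by the type and do no harm (`cls_eq_of_sameType`).

An algebraic imaginary `cls E b` lies in a finite set `D` definable over a finite tuple `a` of `A`.
By saturation, an element of `D` that no definable set over `A` separates from `cls E b` is the
class of a realization of `tp(b/a)`, hence equals `cls E b`. Finitely many separating sets then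
isolate `cls E b`.

Categoricity is used only to make `M`, which may be uncountable, homogeneous and saturated. Both
properties come from a countably saturated ultrapower, compared with `M` through countable
elementary substructures. Homogeneity also shows that truth in `M^eq` depends only on types of
representatives. -/

namespace ImaginaryClosure

/-! ### Equality of types, possibly across structures -/

section SameType

variable (L : FirstOrder.Language.{u, v})

/-- Two tuples, possibly in different structures, satisfy the same formulas. -/
def SameType {α M N : Type*} [L.Structure M] [L.Structure N] (a : α → M) (b : α → N) : Prop :=
  ∀ φ : L.Formula α, φ.Realize a ↔ φ.Realize b

variable {L} {α β M N K : Type*} [L.Structure M] [L.Structure N] [L.Structure K]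

theorem SameType.refl (a : α → M) : SameType L a a := fun _ => Iff.rfl

theorem SameType.symm {a : α → M} {b : α → N} (h : SameType L a b) : SameType L b a :=
  fun φ => (h φ).symm

theorem SameType.trans {a : α → M} {b : α → N} {c : α → K} (h : SameType L a b)
    (h' : SameType L b c) : SameType L a c :=
  fun φ => (h φ).trans (h' φ)

theorem SameType.comp {a : α → M} {b : α → N} (h : SameType L a b) (g : β → α) :
    SameType L (a ∘ g) (b ∘ g) := fun φ => by
  rw [← Formula.realize_relabel, ← Formula.realize_relabel]
  exact h _

theorem SameType.of_forall_imp {a : α → M} {b : α → N}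
    (h : ∀ φ : L.Formula α, φ.Realize a → φ.Realize b) : SameType L a b := fun φ =>
  ⟨h φ, fun hb => by
    by_contra ha
    exact Formula.realize_not.1 (h φ.not (Formula.realize_not.2 ha)) hb⟩

theorem SameType.eq_iff {a : α → M} {b : α → N} (h : SameType L a b) (i j : α) :
    a i = a j ↔ b i = b j := by
  simpa using h (Term.equal (var i) (var j))

theorem SameType.exists_realize {ι : Type*} [Finite ι] [Finite β] {a : α → M} {b : α → N}
    (h : SameType L a b) (φ : ι → L.Formula (α ⊕ β)) (c : β → M)
    (hc : ∀ i, (φ i).Realize (Sum.elim a c)) : ∃ d : β → N, ∀ i, (φ i).Realize (Sum.elim b d) := by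
  have := (h (Formula.iExs β (Formula.iInf φ))).1
    (Formula.realize_iExs.2 ⟨c, Formula.realize_iInf.2 hc⟩)
  obtain ⟨d, hd⟩ := Formula.realize_iExs.1 this
  exact ⟨d, Formula.realize_iInf.1 hd⟩

theorem sameType_equiv (e : M ≃[L] N) (a : α → M) : SameType L a (e ∘ a) := fun φ =>
  (StrongHomClass.realize_formula e φ).symm

theorem sameType_coe (S : L.ElementarySubstructure M) (a : α → S) :
    SameType L a (fun i => (a i : M)) := fun φ =>
  (S.subtype.map_formula φ a).symm

theorem tp_eq_iff {α : Type} {M : Type w} [L.Structure M] [Nonempty M] {a b : α → M} :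
    tp L a = tp L b ↔ SameType L a b := by
  constructor
  · intro h φ
    have h1 : Formula.equivSentence φ ∈ tp L a ↔ Formula.equivSentence φ ∈ tp L b := by rw [h]
    simpa [tp] using h1
  · intro h
    refine SetLike.ext fun φ => ?_
    simp only [tp, Theory.CompleteType.mem_typeOf]
    exact h _

end SameType

/-! ### Homogeneity and saturation -/

section Homogeneous

variable (L : FirstOrder.Language.{u, v})

/-- `ω`-homogeneity. -/
def Homogeneous (M : Type w) [L.Structure M] : Prop :=
  ∀ (n : ℕ) (a b : Fin n → M) (c : M), SameType L a b →
    ∃ d : M, SameType L (Sum.elim a (fun _ : Unit => c)) (Sum.elim b (fun _ : Unit => d))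

/-- `ω`-saturation. -/
def Saturated (M : Type w) [L.Structure M] : Prop :=
  ∀ (α β : Type) [Finite α] [Finite β] (b : α → M) (Γ : Set (L.Formula (α ⊕ β))),
    (∀ F : Finset (L.Formula (α ⊕ β)), (F : Set _) ⊆ Γ →
      ∃ d : β → M, ∀ φ ∈ F, φ.Realize (Sum.elim b d)) →
    ∃ d : β → M, ∀ φ ∈ Γ, φ.Realize (Sum.elim b d)

variable {L} {M : Type w} [L.Structure M]

theorem Homogeneous.exists_elem (hM : Homogeneous L M) {α : Type} [Finite α] {a b : α → M}
    (h : SameType L a b) (c : M) :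
    ∃ d : M, SameType L (Sum.elim a (fun _ : Unit => c)) (Sum.elim b (fun _ : Unit => d)) := by
  obtain ⟨n, ⟨e⟩⟩ := Finite.exists_equiv_fin α
  obtain ⟨d, hd⟩ := hM n (a ∘ e.symm) (b ∘ e.symm) c (h.comp _)
  refine ⟨d, ?_⟩
  convert hd.comp (Sum.map e id) using 1 <;> ext (i | i) <;> simp

theorem Homogeneous.exists_tuple (hM : Homogeneous L M) {α β : Type} [Finite α] [Finite β]
    {a b : α → M} (h : SameType L a b) (c : β → M) :
    ∃ d : β → M, SameType L (Sum.elim a c) (Sum.elim b d) := by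
  induction β using Finite.induction_empty_option with
  | of_equiv e ih =>
    obtain ⟨d, hd⟩ := ih (c ∘ e)
    refine ⟨d ∘ e.symm, ?_⟩
    convert hd.comp (Sum.map id e.symm) using 1 <;> ext (i | i) <;> simp
  | h_empty =>
    refine ⟨PEmpty.elim, ?_⟩
    convert h.comp (Sum.elim id PEmpty.elim) using 1 <;> ext (i | i) <;> first | rfl | cases i
  | h_option ih =>
    obtain ⟨d, hd⟩ := ih (c ∘ some)
    obtain ⟨d0, hd0⟩ := hM.exists_elem hd (c none)
    refine ⟨fun o => o.elim d0 d, ?_⟩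
    convert hd0.comp (Sum.elim (Sum.inl ∘ Sum.inl)
      (fun o : Option _ => o.elim (Sum.inr ()) (Sum.inl ∘ Sum.inr))) using 1 <;>
      ext (i | i | i) <;> rfl

theorem Homogeneous.of_equiv {N : Type w} [L.Structure N] (hM : Homogeneous L M) (e : M ≃[L] N) :
    Homogeneous L N := by
  intro n a b c h
  have key : ∀ {α : Type} (x : α → N), SameType L (e.symm ∘ x) x :=
    fun x => (sameType_equiv e.symm x).symm
  obtain ⟨d, hd⟩ := hM n (e.symm ∘ a) (e.symm ∘ b) (e.symm c)
    ((key a).trans (h.trans (key b).symm))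
  refine ⟨e d, ?_⟩
  have h1 := (sameType_equiv e _).symm.trans (hd.trans (sameType_equiv e _))
  convert h1 using 1 <;> ext (i | i) <;> simp

end Homogeneous

/-! ### Countable saturation of ultrapowers -/

section Ultrapower

variable {L : FirstOrder.Language.{u, v}} (M : Type w) [L.Structure M]

/-- The ultrapower of `M` by a nonprincipal ultrafilter on `ℕ`. -/
abbrev UPower : Type w := ((Filter.hyperfilter ℕ : Ultrafilter ℕ) : Filter ℕ).Product fun _ => M

variable {M} [Nonempty M]

/-- Diagonalization: at index `i`, choose a tuple satisfying as long an initial segment of the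
formulas as possible, of length at most `i`. By Łoś's theorem the resulting sequence satisfies each
formula on a large set of indices. -/
theorem upower_saturated_seq {α β : Type} (b : α → UPower M) (φ : ℕ → L.Formula (α ⊕ β))
    (h : ∀ k, ∃ d : β → UPower M, ∀ j < k, (φ j).Realize (Sum.elim b d)) :
    ∃ d : β → UPower M, ∀ j, (φ j).Realize (Sum.elim b d) := by
  classical
  have lift : ∀ {γ : Type} (x : γ → UPower M), ∃ y : γ → ℕ → M, x = fun i => (y i : UPower M) :=
    fun x => ⟨fun i => (x i).out, funext fun i => (Quotient.out_eq (x i)).symm⟩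
  obtain ⟨b, rfl⟩ := lift b
  have los : ∀ (d : β → ℕ → M) (ψ : L.Formula (α ⊕ β)),
      ψ.Realize (Sum.elim (fun i => (b i : UPower M)) (fun i => (d i : UPower M))) ↔
        ∀ᶠ i in (Filter.hyperfilter ℕ : Filter ℕ),
          ψ.Realize (Sum.elim (fun j => b j i) (fun j => d j i)) := by
    intro d ψ
    have := Ultraproduct.realize_formula_cast (u := Filter.hyperfilter ℕ) (M := fun _ => M) ψ
      (Sum.elim b d)
    convert this using 2
    · ext (i | i) <;> rfl
    · ext i
      apply iff_of_eq
      congr 1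
      ext (j | j) <;> rfl
  let good : ℕ → ℕ → Prop := fun i k =>
    ∃ d : β → M, ∀ j < k, (φ j).Realize (Sum.elim (fun l => b l i) d)
  have hgood : ∀ k, ∀ᶠ i in (Filter.hyperfilter ℕ : Filter ℕ), good i k := by
    intro k
    obtain ⟨d, hd⟩ := h k
    obtain ⟨d, rfl⟩ := lift d
    have : ∀ᶠ i in (Filter.hyperfilter ℕ : Filter ℕ), ∀ j ∈ Finset.range k,
        (φ j).Realize (Sum.elim (fun l => b l i) (fun l => d l i)) := by
      rw [Filter.eventually_all_finset]
      exact fun j hj => (los d _).1 (hd j (Finset.mem_range.1 hj))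
    filter_upwards [this] with i hi
    exact ⟨_, fun j hj => hi j (Finset.mem_range.2 hj)⟩
  have h0 : ∀ i, good i 0 := fun i => ⟨fun _ => Classical.arbitrary M, by simp⟩
  have hK : ∀ i, good i (Nat.findGreatest (good i) i) := fun i =>
    Nat.findGreatest_spec (P := good i) (Nat.zero_le i) (h0 i)
  choose d hd using hK
  refine ⟨fun l => ((fun i => d i l : ℕ → M) : UPower M), fun j => ?_⟩
  refine (los (fun l i => d i l) _).2 ?_
  -- The cap at `i` on the length of the segment is harmless because the ultrafilter is
  -- nonprincipal.
  have hlarge : ∀ᶠ i in (Filter.hyperfilter ℕ : Filter ℕ), j + 1 ≤ i :=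
    (Nat.hyperfilter_le_atTop) (Filter.eventually_ge_atTop (j + 1))
  filter_upwards [hgood (j + 1), hlarge] with i hi hji
  exact hd i j (Nat.le_findGreatest hji hi)

theorem upower_saturated [Countable L.Symbols] : Saturated L (UPower M) := by
  classical
  intro α β _ _ b Γ hΓ
  rcases Γ.eq_empty_or_nonempty with rfl | hne
  · obtain ⟨d, -⟩ := hΓ ∅ (by simp)
    exact ⟨d, by simp⟩
  · obtain ⟨φ, rfl⟩ := (Set.to_countable Γ).exists_eq_range hne
    obtain ⟨d, hd⟩ := upower_saturated_seq b φ fun k => by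
      obtain ⟨d, hd⟩ := hΓ ((Finset.range k).image φ) (by
        intro x hx
        obtain ⟨j, -, rfl⟩ := Finset.mem_image.1 (Finset.mem_coe.1 hx)
        exact ⟨j, rfl⟩)
      exact ⟨d, fun j hj => hd _ (Finset.mem_image_of_mem _ (Finset.mem_range.2 hj))⟩
    exact ⟨d, by rintro _ ⟨j, rfl⟩; exact hd j⟩

omit [Nonempty M] in
theorem Saturated.homogeneous (hM : Saturated L M) : Homogeneous L M := by
  intro n a b c h
  obtain ⟨d, hd⟩ := hM (Fin n) Unit b {φ | φ.Realize (Sum.elim a (fun _ : Unit => c))} (by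
    intro F hF
    obtain ⟨d, hd⟩ := h.exists_realize (fun φ : F => (φ : L.Formula (Fin n ⊕ Unit)))
      (fun _ : Unit => c) (fun φ => hF φ.2)
    exact ⟨d, fun φ hφ => hd ⟨φ, hφ⟩⟩)
  exact ⟨d (), SameType.of_forall_imp hd⟩

theorem sameType_diagonal {α : Type*} (a : α → M) :
    SameType L a (fun i => ((fun _ => a i : ℕ → M) : UPower M)) := by
  intro φ
  rw [Ultraproduct.realize_formula_cast (u := Filter.hyperfilter ℕ) (M := fun _ => M) φ
    (fun i _ => a i)]
  simp

end Ultrapower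

/-! ### Countable homogeneous elementary substructures -/

section Countable

open Cardinal

/-- Function symbols for homogeneity witnesses: a symbol of arity `r` selects from its arguments
two `n`-tuples and a further element. -/
def witnessLanguage : FirstOrder.Language.{0, 0} where
  Functions r := Σ n : ℕ, (Fin n → Fin r) × (Fin n → Fin r) × Fin r
  Relations _ := Empty

theorem card_sum_witnessLanguage_le (L : FirstOrder.Language.{u, v}) [Countable L.Symbols] :
    (L.sum witnessLanguage).card ≤ ℵ₀ := by
  have h1 : L.card ≤ ℵ₀ := mk_le_aleph0
  have h2 : witnessLanguage.card ≤ ℵ₀ := by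
    have hf : Countable (Σ r, witnessLanguage.Functions r) :=
      inferInstanceAs (Countable (Σ r : ℕ, Σ n : ℕ, (Fin n → Fin r) × (Fin n → Fin r) × Fin r))
    have hr : Countable (Σ r, witnessLanguage.Relations r) :=
      inferInstanceAs (Countable (Σ _ : ℕ, Empty))
    exact mk_le_aleph0_iff.2 (inferInstanceAs (Countable (_ ⊕ _)))
  rw [card_sum]
  exact add_le_aleph0.2 ⟨lift_le_aleph0.2 h1, lift_le_aleph0.2 h2⟩

variable {L : FirstOrder.Language.{u, v}} {M : Type w} [L.Structure M]

theorem exists_elementarySubstructure_card_eq_aleph0 [Infinite M] (hL : L.card ≤ ℵ₀)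
    (s : Set M) (hs : s.Countable) :
    ∃ S : L.ElementarySubstructure M, s ⊆ S ∧ #S = ℵ₀ := by
  obtain ⟨S, h, hS⟩ := exists_elementarySubstructure_card_eq L s (ℵ₀ : Cardinal.{w}) le_rfl
    (by simpa using hs.le_aleph0) (by simpa using hL) (by simp [aleph0_le_mk])
  exact ⟨S, h, by simpa using hS⟩

/-- Downward Löwenheim–Skolem in a language with functions that choose homogeneity witnesses: a
substructure closed under them is homogeneous. -/
theorem Homogeneous.exists_countable [Countable L.Symbols] [Infinite M] (hM : Homogeneous L M) (s : Set M)
    (hs : s.Countable) :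
    ∃ S : L.ElementarySubstructure M, s ⊆ S ∧ #S = ℵ₀ ∧ Homogeneous L S := by
  classical
  have : Nonempty M := inferInstance
  let _ : witnessLanguage.Structure M :=
    { funMap := fun {r} f x => Classical.epsilon fun d : M =>
        SameType L (Sum.elim (x ∘ f.2.1) (fun _ : Unit => x f.2.2.2))
          (Sum.elim (x ∘ f.2.2.1) (fun _ : Unit => d))
      RelMap := fun R _ => R.elim }
  obtain ⟨T, hsT, hT⟩ := exists_elementarySubstructure_card_eq_aleph0 (M := M)
    (card_sum_witnessLanguage_le L) s hs
  have helem : (LHom.sumInl (L := L) (L' := witnessLanguage).substructureReduct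
      T.toSubstructure).IsElementary := by
    apply Substructure.isElementary_of_exists
    intro n φ x a h
    -- Tarski–Vaught test for the reduct: the existential `L`-formula is read in the larger
    -- language, where `T` is already elementary.
    let φ' : (L.sum witnessLanguage).BoundedFormula Empty n :=
      ((LHom.sumInl : L →ᴸ L.sum witnessLanguage).onBoundedFormula φ).ex
    have h1 : φ'.Realize (default : Empty → M) ((↑) ∘ x) :=
      BoundedFormula.realize_ex.2 ⟨a, by rwa [LHom.realize_onBoundedFormula]⟩
    let y : Fin n → T := x
    have hdef : (T.subtype ∘ default : Empty → M) = default := Subsingleton.elim _ _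
    have h2 : φ'.Realize (default : Empty → T) y := by
      rw [← T.subtype.map_boundedFormula, hdef]
      exact h1
    obtain ⟨b, hb⟩ := BoundedFormula.realize_ex.1 h2
    refine ⟨b, ?_⟩
    rw [← T.subtype.map_boundedFormula, LHom.realize_onBoundedFormula] at hb
    rw [Fin.comp_snoc, hdef] at hb
    exact hb
  let S : L.ElementarySubstructure M := ⟨_, helem⟩
  refine ⟨S, hsT, hT, ?_⟩
  intro n a b c h
  -- The arguments are `a`, `b` and `c` listed in this order.
  let f : witnessLanguage.Functions (n + n + 1) :=
    ⟨n, fun i => Fin.castSucc (Fin.castAdd n i), fun i => Fin.castSucc (Fin.natAdd n i),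
      Fin.last _⟩
  let x : Fin (n + n + 1) → M := Fin.snoc (α := fun _ => M)
    (Fin.append (fun i => (a i : M)) (fun i => (b i : M))) (c : M)
  have xa : x ∘ f.2.1 = fun i => (a i : M) := funext fun i =>
    (Fin.snoc_castSucc (α := fun _ => M) _ _ _).trans (Fin.append_left _ _ i)
  have xb : x ∘ f.2.2.1 = fun i => (b i : M) := funext fun i =>
    (Fin.snoc_castSucc (α := fun _ => M) _ _ _).trans (Fin.append_right _ _ i)
  have xc : x f.2.2.2 = c := Fin.snoc_last (α := fun _ => M) _ _
  have hx : ∀ i, x i ∈ T := by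
    refine Fin.lastCases ?_ fun i => ?_
    · exact xc ▸ c.2
    · refine Fin.addCases (fun j => ?_) (fun j => ?_) i
      · exact (show x (f.2.1 j) = a j from congrFun xa j) ▸ (a j).2
      · exact (show x (f.2.2.1 j) = b j from congrFun xb j) ▸ (b j).2
  have hd : Structure.funMap (L := witnessLanguage) f x ∈ T :=
    T.toSubstructure.fun_mem (Sum.inr f : (L.sum witnessLanguage).Functions _) x hx
  have hspec : SameType L (Sum.elim (x ∘ f.2.1) (fun _ : Unit => x f.2.2.2))
      (Sum.elim (x ∘ f.2.2.1) (fun _ : Unit => Structure.funMap (L := witnessLanguage) f x)) := by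
    refine Classical.epsilon_spec (p := fun d : M =>
        SameType L (Sum.elim (x ∘ f.2.1) (fun _ : Unit => x f.2.2.2))
          (Sum.elim (x ∘ f.2.2.1) (fun _ : Unit => d))) ?_
    rw [xa, xb, xc]
    exact hM n _ _ _ ((sameType_coe S a).symm.trans (h.trans (sameType_coe S b)))
  rw [xa, xb, xc] at hspec
  refine ⟨⟨_, hd⟩, (sameType_coe S _).trans (SameType.trans ?_ (sameType_coe S _).symm)⟩
  convert hspec using 1 <;> ext (i | i) <;> rfl

end Countable

/-! ### Categoricity implies homogeneity and saturation -/

section Categorical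

open Cardinal

variable {L : FirstOrder.Language.{u, v}} {M : Type w} [L.Structure M] [Nonempty M]

theorem OmegaCategorical.nonempty_equiv (hcat : OmegaCategorical L M) {S T : Type w}
    [L.Structure S] [L.Structure T] (hS : M ≅[L] S) (hT : M ≅[L] T)
    (cS : #S = ℵ₀) (cT : #T = ℵ₀) : Nonempty (S ≃[L] T) := by
  have : Nonempty S := hS.nonempty
  have : Nonempty T := hT.nonempty
  have mS : S ⊨ L.completeTheory M := by
    rw [Theory.model_iff_subset_completeTheory, ← hS.completeTheory_eq]
  have mT : T ⊨ L.completeTheory M := by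
    rw [Theory.model_iff_subset_completeTheory, ← hT.completeTheory_eq]
  exact hcat (Theory.ModelType.of _ S) (Theory.ModelType.of _ T) cS cT

theorem elementarilyEquivalent_upower : M ≅[L] UPower M := by
  rw [elementarilyEquivalent_iff]
  intro φ
  rw [Ultraproduct.sentence_realize]
  simp

variable [Countable L.Symbols] [Infinite M]

omit [L.Structure M] [Nonempty M] [Countable L.Symbols] in
theorem infinite_upower : Infinite (UPower M) :=
  have : Nonempty M := inferInstance
  -- Infinitude is already expressed by sentences of the empty language.
  let _ : Language.empty.Structure M := emptyStructure
  (elementarilyEquivalent_upower (L := Language.empty) (M := M)).infinite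

/-- A countable elementary substructure of `M` containing `a`, `b`, `c` is isomorphic to a countable
homogeneous one of the ultrapower, so the witness is found inside it. -/
theorem OmegaCategorical.homogeneous (hcat : OmegaCategorical L M) : Homogeneous L M := by
  intro n a b c h
  have := infinite_upower (M := M)
  obtain ⟨S, -, cS, hS⟩ := (upower_saturated (L := L) (M := M)).homogeneous.exists_countable
    ∅ countable_empty
  obtain ⟨T, hT, cT⟩ := exists_elementarySubstructure_card_eq_aleph0 (L := L) mk_le_aleph0
    (insert c (range a ∪ range b))
    (((countable_range a).union (countable_range b)).insert c)
  obtain ⟨e⟩ := hcat.nonempty_equiv (elementarilyEquivalent_upower.trans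
    S.elementarilyEquivalent.symm) T.elementarilyEquivalent.symm cS cT
  let a' : Fin n → T := fun i => ⟨a i, hT (Or.inr (Or.inl ⟨i, rfl⟩))⟩
  let b' : Fin n → T := fun i => ⟨b i, hT (Or.inr (Or.inr ⟨i, rfl⟩))⟩
  obtain ⟨d, hd⟩ := (hS.of_equiv e) n a' b' ⟨c, hT (Or.inl rfl)⟩
    ((sameType_coe T a').trans (h.trans (sameType_coe T b').symm))
  refine ⟨d, ?_⟩
  convert (sameType_coe T _).symm.trans (hd.trans (sameType_coe T _)) using 1 <;>
    ext (i | i) <;> rfl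

/-- A realization in the ultrapower over the diagonal copy of `b` lies in a countable elementary
substructure, which categoricity maps into `M`. This moves `b` to another tuple of the same type,
and homogeneity brings the realization back over `b`. -/
theorem OmegaCategorical.saturated (hcat : OmegaCategorical L M) : Saturated L M := by
  intro α β _ _ b Γ hΓ
  have := infinite_upower (M := M)
  let b₁ : α → UPower M := fun i => ((fun _ => b i : ℕ → M) : UPower M)
  have hb₁ : SameType L b b₁ := sameType_diagonal b
  obtain ⟨c, hc⟩ := upower_saturated α β b₁ Γ fun F hF => by
    obtain ⟨d, hd⟩ := hΓ F hF
    obtain ⟨d', hd'⟩ := hb₁.exists_realize (fun φ : F => (φ : L.Formula (α ⊕ β))) d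
      fun φ => hd φ φ.2
    exact ⟨d', fun φ hφ => hd' ⟨φ, hφ⟩⟩
  obtain ⟨S, hS, cS⟩ := exists_elementarySubstructure_card_eq_aleph0 (L := L) mk_le_aleph0
    (range b₁ ∪ range c) ((countable_range b₁).union (countable_range c))
  obtain ⟨T, -, cT⟩ := exists_elementarySubstructure_card_eq_aleph0 (L := L) (M := M) mk_le_aleph0
    ∅ countable_empty
  obtain ⟨e⟩ := hcat.nonempty_equiv (elementarilyEquivalent_upower.trans
    S.elementarilyEquivalent.symm) T.elementarilyEquivalent.symm cS cT
  let x : α ⊕ β → S := Sum.elim (fun i => ⟨b₁ i, hS (Or.inl ⟨i, rfl⟩)⟩)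
    (fun i => ⟨c i, hS (Or.inr ⟨i, rfl⟩)⟩)
  have hx : SameType L (Sum.elim b₁ c) (fun i => (e (x i) : M)) := by
    refine SameType.trans ?_ ((sameType_equiv e x).trans (sameType_coe T _))
    convert (sameType_coe S x).symm using 1
    ext (i | i) <;> rfl
  obtain ⟨d, hd⟩ := hcat.homogeneous.exists_tuple
    ((hx.comp Sum.inl).symm.trans hb₁.symm) (fun i => (e (x (Sum.inr i)) : M))
  refine ⟨d, fun φ hφ => (hd φ).1 ?_⟩
  have := (hx φ).1 (hc φ hφ)
  convert this using 1
  ext (i | i) <;> rfl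

end Categorical

/-! ### Realizations avoiding finite sets -/

section Avoidance

variable {L : FirstOrder.Language.{u, v}} {M : Type w} [L.Structure M]

theorem DegenerateAcl.infinite [Nonempty M] (h : DegenerateAcl L M) : Infinite M := by
  by_contra hfin
  rw [not_infinite_iff_finite] at hfin
  have : Classical.arbitrary M ∈ acl L (∅ : Set M) :=
    ⟨univ, definable_univ, toFinite _, mem_univ _⟩
  rw [h ∅] at this
  exact this

theorem definable₁_of_formula {α : Type} (b : α → M) {A : Set M} (hA : range b ⊆ A)
    (φ : L.Formula (α ⊕ Unit)) :
    A.Definable₁ L {d | φ.Realize (Sum.elim b fun _ => d)} := by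
  unfold Definable₁
  rw [definable_iff_exists_formula_sum]
  refine ⟨φ.relabel (Sum.map (fun i => ⟨b i, hA ⟨i, rfl⟩⟩) fun _ => 0), ?_⟩
  ext x
  simp only [mem_ofPred_eq, Formula.realize_relabel]
  apply iff_of_eq
  congr 1
  ext (i | i) <;> rfl

/-- If algebraic closure is degenerate, realizations of types can be chosen to avoid a given
finite set. -/
theorem DegenerateAcl.exists_avoiding_elem (h : DegenerateAcl L M) (hh : Homogeneous L M)
    (hs : Saturated L M) {α : Type} [Finite α] {a b : α → M} (hab : SameType L a b) (c : M)
    (B : Finset M) :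
    ∃ d : M, SameType L (Sum.elim a fun _ : Unit => c) (Sum.elim b fun _ : Unit => d) ∧
      (c ∉ range a → d ∉ B) := by
  classical
  obtain ⟨d₀, hd₀⟩ := hh.exists_elem hab c
  by_cases hc : c ∈ range a
  · exact ⟨d₀, hd₀, fun h => (h hc).elim⟩
  have hd₀b : d₀ ∉ range b := by
    rintro ⟨i, hi⟩
    exact hc ⟨i, (hd₀.eq_iff (Sum.inl i) (Sum.inr ())).2 hi⟩
  let B' : Fin B.card → M := fun i => B.equivFin.symm i
  have hB' : ∀ d, d ∈ B ↔ ∃ i, B' i = d := fun d =>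
    ⟨fun hd => ⟨B.equivFin ⟨d, hd⟩, by simp [B']⟩, by rintro ⟨i, rfl⟩; exact (B.equivFin.symm i).2⟩
  let g : {φ : L.Formula (α ⊕ Unit) // φ.Realize (Sum.elim a fun _ => c)} ⊕ Fin B.card →
      L.Formula ((α ⊕ Fin B.card) ⊕ Unit) :=
    Sum.elim (fun φ => φ.1.relabel (Sum.map Sum.inl id))
      fun x => (Term.equal (var (Sum.inr ())) (var (Sum.inl (Sum.inr x)))).not
  have hg₁ : ∀ φ d, (g (Sum.inl φ)).Realize (Sum.elim (Sum.elim b B') d) ↔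
      φ.1.Realize (Sum.elim b d) := by
    intro φ d
    simp only [g, Sum.elim_inl, Formula.realize_relabel]
    apply iff_of_eq
    congr 1
    ext (i | i) <;> rfl
  have hg₂ : ∀ x d, (g (Sum.inr x)).Realize (Sum.elim (Sum.elim b B') d) ↔
      d () ≠ B' x := by
    intro x d
    simp [g]
  -- Finite satisfiability: a formula true of `d₀` has infinitely many solutions, since otherwise
  -- `d₀` would be algebraic over `b` and hence an entry of `b`. So some solution lies outside `B`.
  obtain ⟨d, hd⟩ := hs (α ⊕ Fin B.card) Unit (Sum.elim b B') (range g) fun F hF => by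
    choose k hk using fun ψ : F => hF ψ.2
    let θ : L.Formula (α ⊕ Unit) :=
      Formula.iInf fun ψ : F => Sum.elim (fun φ => φ.1) (fun _ => ⊤) (k ψ)
    have hθ : θ.Realize (Sum.elim a fun _ => c) := by
      refine Formula.realize_iInf.2 fun ψ => ?_
      rcases k ψ with φ | x
      · exact φ.2
      · simp
    have hinf : {d | θ.Realize (Sum.elim b fun _ => d)}.Infinite := by
      intro hfin
      have : d₀ ∈ acl L (range b) :=
        ⟨_, definable₁_of_formula b Subset.rfl θ, hfin, (hd₀ θ).1 hθ⟩
      rw [h] at this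
      exact hd₀b this
    obtain ⟨d, hd, hdB⟩ := hinf.exists_notMem_finset B
    refine ⟨fun _ => d, fun ψ hψ => ?_⟩
    have h1 := Formula.realize_iInf.1 hd ⟨ψ, hψ⟩
    have h2 := hk ⟨ψ, hψ⟩
    change g _ = ψ at h2
    rw [← h2]
    rcases hkψ : k ⟨ψ, hψ⟩ with φ | x
    · rw [hkψ] at h1
      exact (hg₁ φ _).2 h1
    · exact (hg₂ x _).2 fun e => hdB ((hB' d).2 ⟨x, e.symm⟩)
  refine ⟨d (), SameType.of_forall_imp fun φ hφ => (hg₁ ⟨φ, hφ⟩ _).1 (hd _ ⟨_, rfl⟩),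
    fun _ hB => ?_⟩
  obtain ⟨x, hx⟩ := (hB' _).1 hB
  exact (hg₂ x _).1 (hd _ ⟨_, rfl⟩) hx.symm

theorem DegenerateAcl.exists_avoiding (h : DegenerateAcl L M) (hh : Homogeneous L M)
    (hs : Saturated L M) {α β : Type} [Finite α] [Finite β] {a b : α → M} (hab : SameType L a b)
    (c : β → M) (B : Finset M) :
    ∃ d : β → M, SameType L (Sum.elim a c) (Sum.elim b d) ∧ ∀ i, c i ∉ range a → d i ∉ B := by
  induction β using Finite.induction_empty_option with
  | of_equiv e ih =>
    obtain ⟨d, hd, hB⟩ := ih (c ∘ e)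
    refine ⟨d ∘ e.symm, ?_, fun i hi => hB (e.symm i) (by simpa using hi)⟩
    convert hd.comp (Sum.map id e.symm) using 1 <;> ext (i | i) <;> simp
  | h_empty =>
    refine ⟨PEmpty.elim, ?_, fun i => i.elim⟩
    convert hab.comp (Sum.elim id PEmpty.elim) using 1 <;> ext (i | i) <;> first | rfl | cases i
  | h_option ih =>
    obtain ⟨d, hd, hB⟩ := ih (c ∘ some)
    obtain ⟨d₀, hd₀, hB₀⟩ := h.exists_avoiding_elem hh hs hd (c none) B
    refine ⟨fun o => o.elim d₀ d, ?_, ?_⟩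
    · convert hd₀.comp (Sum.elim (Sum.inl ∘ Sum.inl)
        (fun o : Option _ => o.elim (Sum.inr ()) (Sum.inl ∘ Sum.inr))) using 1 <;>
        ext (i | i | i) <;> rfl
    · rintro (_ | i) hi
      -- If the new entry repeats an earlier entry of `c`, equality of types forces the same
      -- repetition in `d`, and the earlier entry already avoids `B`.
      · by_cases hc : c none ∈ range (Sum.elim a (c ∘ some))
        · obtain ⟨j | j, hj⟩ := hc
          · exact (hi ⟨j, hj⟩).elim
          · have : d j = d₀ := (hd₀.eq_iff (Sum.inl (Sum.inr j)) (Sum.inr ())).1 hj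
            change d₀ ∉ B
            rw [← this]
            refine hB j ?_
            change c (some j) = c none at hj
            simpa [hj] using hi
        · exact hB₀ hc
      · exact hB i hi

end Avoidance

/-! ### Types of representatives determine truth among imaginaries -/

section Imaginary

variable {L : FirstOrder.Language.{u, v}} {M : Type w} [L.Structure M]

theorem Meq.cls_eq_iff {E : EqSort L M} {a b : Fin E.arity → M} :
    Meq.cls E a = Meq.cls E b ↔ E.rel a b := by
  constructor
  · intro h
    exact Quotient.exact (eq_of_heq (Sigma.mk.inj h).2)
  · intro h
    exact congrArg (Sigma.mk E) (Quotient.sound h)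

theorem Meq.exists_eq_cls (x : Meq L M) : ∃ (E : EqSort L M) (a : Fin E.arity → M),
    x = Meq.cls E a := by
  obtain ⟨E, q⟩ := x
  obtain ⟨a, rfl⟩ := Quotient.exists_rep q
  exact ⟨E, a, rfl⟩

theorem Meq.real_injective : Function.Injective (Meq.real L : M → Meq L M) := fun _ _ h =>
  congrFun (show (homeSort L M).rel _ _ from Meq.cls_eq_iff.1 h) (0 : Fin 1)

theorem SameType.rel_iff {γ : Type*} {s s' : γ → M} (h : SameType L s s') (E : EqSort L M)
    (f g : Fin E.arity → γ) : E.rel (s ∘ f) (s ∘ g) ↔ E.rel (s' ∘ f) (s' ∘ g) := by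
  obtain ⟨φ, hφ⟩ := empty_definable_iff.1 E.definable
  have key : ∀ t : γ → M, E.rel (t ∘ f) (t ∘ g) ↔ (φ.relabel (Sum.elim f g)).Realize t := by
    intro t
    rw [Formula.realize_relabel]
    have := Set.ext_iff.1 hφ (t ∘ Sum.elim f g)
    exact this
  rw [key, key]
  exact h _

/-- Two families of imaginaries are represented, in the same way, by finite tuples with the same
type. -/
def EqSame {ι : Type*} (x y : ι → Meq L M) : Prop :=
  ∃ (β : Type) (_ : Finite β) (t t' : β → M), SameType L t t' ∧
    ∀ i, ∃ (E : EqSort L M) (g : Fin E.arity → β),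
      x i = Meq.cls E (t ∘ g) ∧ y i = Meq.cls E (t' ∘ g)

theorem EqSame.symm {ι : Type*} {x y : ι → Meq L M} (h : EqSame x y) : EqSame y x := by
  obtain ⟨β, hβ, t, t', ht, h⟩ := h
  exact ⟨β, hβ, t', t, ht.symm, fun i => (h i).imp fun E => Exists.imp fun g => And.symm⟩

theorem EqSame.comp {ι κ : Type*} {x y : ι → Meq L M} (h : EqSame x y) (f : κ → ι) :
    EqSame (x ∘ f) (y ∘ f) := by
  obtain ⟨β, hβ, t, t', ht, h⟩ := h
  exact ⟨β, hβ, t, t', ht, fun i => h (f i)⟩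

/-- Frees `EqSame` from its particular representatives: since each sort is definable without
parameters, homogeneity carries any chosen representatives of `x` to representatives of `y`. -/
theorem EqSame.exists_tuple (hh : Homogeneous L M) {ι : Type*} {x y : ι → Meq L M}
    (h : EqSame x y) {γ : Type} [Finite γ] (s : γ → M) :
    ∃ s' : γ → M, SameType L s s' ∧ ∀ (i : ι) (E : EqSort L M) (g : Fin E.arity → γ),
      x i = Meq.cls E (s ∘ g) → y i = Meq.cls E (s' ∘ g) := by
  obtain ⟨β, hβ, t, t', ht, h⟩ := h
  obtain ⟨s', hs'⟩ := hh.exists_tuple ht s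
  refine ⟨s', hs'.comp Sum.inr, fun i E g hE => ?_⟩
  obtain ⟨E', g', hx, hy⟩ := h i
  obtain rfl : E' = E := congrArg Sigma.fst (hx.symm.trans hE)
  rw [hy, Meq.cls_eq_iff]
  exact (hs'.rel_iff E' (Sum.inl ∘ g') (Sum.inr ∘ g)).1 (Meq.cls_eq_iff.1 (hx.symm.trans hE))

theorem EqSame.exists_elem (hh : Homogeneous L M) {ι : Type*} {x y : ι → Meq L M}
    (h : EqSame x y) (z : Meq L M) :
    ∃ z' : Meq L M, EqSame (Sum.elim x fun _ : Unit => z) (Sum.elim y fun _ : Unit => z') := by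
  obtain ⟨β, hβ, t, t', ht, h⟩ := h
  obtain ⟨E, a, rfl⟩ := z.exists_eq_cls
  obtain ⟨s, hs⟩ := hh.exists_tuple ht a
  refine ⟨Meq.cls E s, β ⊕ Fin E.arity, inferInstance, _, _, hs, ?_⟩
  rintro (i | i)
  · obtain ⟨E', g, hx, hy⟩ := h i
    exact ⟨E', Sum.inl ∘ g, hx, hy⟩
  · exact ⟨E, Sum.inr, rfl, rfl⟩

theorem EqSame.eq_of_eq (hh : Homogeneous L M) {ι : Type*} {x y : ι → Meq L M}
    (h : EqSame x y) {i j : ι} (hij : x i = x j) : y i = y j := by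
  obtain ⟨E, a, ha⟩ := (x i).exists_eq_cls
  obtain ⟨s', -, hs⟩ := h.exists_tuple hh a
  rw [hs i E id ha, hs j E id (hij ▸ ha)]

theorem EqSame.eqRelMap (hh : Homogeneous L M) {n : ℕ} {x y : Fin n → Meq L M}
    (h : EqSame x y) (R : EqRelations L M n) (hR : eqRelMap L M R x) : eqRelMap L M R y := by
  cases R with
  | @graph n f =>
    obtain ⟨a, rfl⟩ := hR
    obtain ⟨s', hs, hy⟩ := h.exists_tuple hh (Sum.elim a fun _ : Unit => Structure.funMap f a)
    have hf : Structure.funMap f (s' ∘ Sum.inl) = s' (Sum.inr ()) := by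
      have := hs (Term.equal (Term.func f fun i => var (Sum.inl i)) (var (Sum.inr ())))
      simp only [Formula.realize_equal, Term.realize_func, Term.realize_var, Sum.elim_inl,
        Sum.elim_inr] at this
      exact this.1 trivial
    refine ⟨s' ∘ Sum.inl, funext (Fin.lastCases ?_ fun i => ?_)⟩
    · rw [Fin.snoc_last, hf]
      exact hy (Fin.last n) (homeSort L M) (fun _ => Sum.inr ()) (by rw [Fin.snoc_last]; rfl)
    · rw [Fin.snoc_castSucc]
      exact hy i.castSucc (homeSort L M) (fun _ => Sum.inl i) (by rw [Fin.snoc_castSucc]; rfl)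
  | rel R =>
    obtain ⟨a, rfl, ha⟩ := hR
    obtain ⟨s', hs, hy⟩ := h.exists_tuple hh a
    refine ⟨s', funext fun i => hy i (homeSort L M) (fun _ => i) rfl, ?_⟩
    have := hs (R.formula fun i => var i)
    simp only [Formula.realize_rel, Term.realize_var] at this
    exact this.1 ha
  | sort E =>
    obtain ⟨a, ha⟩ := hR
    obtain ⟨s', -, hy⟩ := h.exists_tuple hh a
    exact ⟨s', hy 0 E id ha⟩
  | proj E =>
    obtain ⟨a, rfl⟩ := hR
    obtain ⟨s', -, hy⟩ := h.exists_tuple hh a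
    refine ⟨s', funext (Fin.lastCases ?_ fun i => ?_)⟩
    · rw [Fin.snoc_last]
      exact hy _ E id (by rw [Fin.snoc_last]; rfl)
    · rw [Fin.snoc_castSucc]
      exact hy i.castSucc (homeSort L M) (fun _ => i) (by rw [Fin.snoc_castSucc]; rfl)

theorem Leq.term_eq_var {α : Type*} (t : (Leq L M).Term α) : ∃ i, t = var i := by
  cases t with
  | var i => exact ⟨i, rfl⟩
  | func f _ => exact f.elim

/-- Back and forth: `EqSame` preserves atomic formulas and extends by one element on either side,
which handles the quantifier. -/
theorem EqSame.realize_iff (hh : Homogeneous L M) {α : Type*} {n : ℕ}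
    (φ : (Leq L M).BoundedFormula α n) : ∀ {v v' : α → Meq L M} {xs ys : Fin n → Meq L M},
      EqSame (Sum.elim v xs) (Sum.elim v' ys) → (φ.Realize v xs ↔ φ.Realize v' ys) := by
  induction φ with
  | falsum => exact fun _ => Iff.rfl
  | equal t₁ t₂ =>
    intro v v' xs ys h
    obtain ⟨i, rfl⟩ := Leq.term_eq_var t₁
    obtain ⟨j, rfl⟩ := Leq.term_eq_var t₂
    exact ⟨h.eq_of_eq hh, h.symm.eq_of_eq hh⟩
  | rel R ts =>
    intro v v' xs ys h
    choose g hg using fun i => Leq.term_eq_var (ts i)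
    obtain rfl : ts = fun i => var (g i) := funext hg
    exact ⟨(h.comp g).eqRelMap hh R, (h.comp g).symm.eqRelMap hh R⟩
  | imp φ ψ ihφ ihψ => exact fun h => imp_congr (ihφ h) (ihψ h)
  | @all n φ ih =>
    have key : ∀ {v v' : α → Meq L M} {xs ys : Fin n → Meq L M},
        EqSame (Sum.elim v xs) (Sum.elim v' ys) → φ.all.Realize v xs → φ.all.Realize v' ys := by
      intro v v' xs ys h hφ z
      obtain ⟨z', hz⟩ := h.symm.exists_elem hh z
      refine (ih ?_).2 (hφ z')
      convert hz.comp (Sum.elim (Sum.inl ∘ Sum.inl)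
        (Fin.snoc (α := fun _ => (α ⊕ Fin n) ⊕ Unit) (Sum.inl ∘ Sum.inr) (Sum.inr ()))) using 1
      all_goals
        ext (i | i)
        · rfl
        · refine Fin.lastCases ?_ (fun i => ?_) i <;> simp
    intro v v' xs ys h
    exact ⟨key h, key h.symm⟩

theorem EqSame.formula_realize_iff (hh : Homogeneous L M) {α : Type*} {v v' : α → Meq L M}
    (h : EqSame v v') (φ : (Leq L M).Formula α) : φ.Realize v ↔ φ.Realize v' := by
  refine EqSame.realize_iff hh φ ?_
  convert h.comp (Sum.elim id Fin.elim0) using 1 <;> ext (i | i) <;> first | rfl | exact i.elim0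

end Imaginary

/-! ### Translating formulas of `M` into formulas on the home sort -/

section Translation

variable {L : FirstOrder.Language.{u, v}} {M : Type w} [L.Structure M]

/-- The symbol for the graph of a function symbol of `L`. -/
def Leq.graph {n : ℕ} (f : L.Functions n) : (Leq L M).Relations (n + 1) := EqRelations.graph f

/-- The symbol for a relation symbol of `L`. -/
def Leq.rel {n : ℕ} (R : L.Relations n) : (Leq L M).Relations n := EqRelations.rel R

/-- The symbol for the home sort. -/
def Leq.home : (Leq L M).Relations 1 := EqRelations.sort (homeSort L M)

/-- The symbol for the projection onto a sort. -/
def Leq.proj (E : EqSort L M) : (Leq L M).Relations (E.arity + 1) := EqRelations.proj E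

theorem relMap_graph_snoc {n : ℕ} (f : L.Functions n) (b : Fin n → M) (x : Meq L M) :
    Structure.RelMap (L := Leq L M) (Leq.graph f)
      (Fin.snoc (α := fun _ => Meq L M) (fun i => Meq.real L (b i)) x) ↔
      x = Meq.real L (Structure.funMap f b) := by
  constructor
  · rintro ⟨a, ha⟩
    obtain ⟨h₁, h₂⟩ := Fin.snoc_injective2 ha
    obtain rfl : b = a := funext fun i => Meq.real_injective (congrFun h₁ i)
    exact h₂
  · rintro rfl
    exact ⟨b, rfl⟩

theorem relMap_rel_real {n : ℕ} (R : L.Relations n) (b : Fin n → M) :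
    Structure.RelMap (L := Leq L M) (Leq.rel R)
      (fun i => Meq.real L (b i)) ↔ Structure.RelMap R b := by
  constructor
  · rintro ⟨a, ha, h⟩
    obtain rfl : b = a := funext fun i => Meq.real_injective (congrFun ha i)
    exact h
  · exact fun h => ⟨b, rfl, h⟩

theorem relMap_homeSort (x : Fin 1 → Meq L M) :
    Structure.RelMap (L := Leq L M) Leq.home x ↔
      ∃ a, x 0 = Meq.real L a := by
  constructor
  · rintro ⟨a, ha⟩
    refine ⟨a (0 : Fin 1), ha.trans (congrArg _ (funext fun i => ?_))⟩
    exact congrArg a (Subsingleton.elim (α := Fin 1) _ _)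
  · exact fun ⟨a, ha⟩ => ⟨fun _ => a, ha⟩

theorem relMap_proj_snoc (E : EqSort L M) (y : Fin E.arity → Meq L M) (x : Meq L M) :
    Structure.RelMap (L := Leq L M) (Leq.proj E)
      (Fin.snoc (α := fun _ => Meq L M) y x) ↔
      ∃ b : Fin E.arity → M, (y = fun i => Meq.real L (b i)) ∧ x = Meq.cls E b := by
  constructor
  · rintro ⟨a, ha⟩
    obtain ⟨h₁, h₂⟩ := Fin.snoc_injective2 ha
    exact ⟨a, h₁, h₂⟩
  · rintro ⟨b, rfl, rfl⟩
    exact ⟨b, rfl⟩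

theorem exists_boundedFormula_of_formula {L' : FirstOrder.Language} {N : Type*} [L'.Structure N]
    {α : Type*} {n : ℕ} (ψ : L'.Formula (α ⊕ Fin n)) :
    ∃ ψ' : L'.BoundedFormula α n, ∀ (v : α → N) (xs : Fin n → N),
      ψ'.Realize v xs ↔ ψ.Realize (Sum.elim v xs) := by
  refine ⟨BoundedFormula.relabel id ψ, fun v xs => ?_⟩
  rw [BoundedFormula.realize_relabel (n := 0), Formula.boundedFormula_realize_eq_realize]
  rfl

/-- The language of imaginaries is relational, so nested terms are unravelled by quantifying over
the values of subterms. -/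
theorem exists_term_graph {α : Type*} (t : L.Term α) :
    ∃ τ : (Leq L M).Formula (α ⊕ Unit), ∀ (v : α → M) (x : Meq L M),
      τ.Realize (Sum.elim (fun i => Meq.real L (v i)) fun _ => x) ↔
        x = Meq.real L (t.realize v) := by
  induction t with
  | var i =>
    exact ⟨Term.equal (var (Sum.inr ())) (var (Sum.inl i)), fun v x => by simp⟩
  | @func n f ts ih =>
    choose τ hτ using ih
    refine ⟨Formula.iExs (Fin n)
      (Formula.iInf (fun i => (τ i).relabel (Sum.elim (Sum.inl ∘ Sum.inl) fun _ => Sum.inr i)) ⊓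
        Relations.formula (L := Leq L M) (Leq.graph f)
          (Fin.snoc (α := fun _ => (Leq L M).Term ((α ⊕ Unit) ⊕ Fin n))
            (fun i => var (Sum.inr i)) (var (Sum.inl (Sum.inr ()))))), fun v x => ?_⟩
    rw [Formula.realize_iExs]
    simp only [Formula.realize_inf, Formula.realize_iInf, Formula.realize_relabel,
      Formula.realize_rel]
    have h₁ : ∀ (y : Fin n → Meq L M) (i : Fin n),
        (τ i).Realize (Sum.elim (Sum.elim (fun i => Meq.real L (v i)) fun _ => x) y ∘
          (Sum.elim (Sum.inl ∘ Sum.inl) fun _ => Sum.inr i :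
            α ⊕ Unit → (α ⊕ Unit) ⊕ Fin n)) ↔
        y i = Meq.real L ((ts i).realize v) := by
      intro y i
      rw [← hτ]
      apply iff_of_eq
      congr 1
      ext (j | j) <;> rfl
    have h₂ : ∀ y : Fin n → Meq L M, (fun i => Term.realize (L := Leq L M)
        (Sum.elim (Sum.elim (fun i => Meq.real L (v i)) fun _ => x) y)
        (Fin.snoc (α := fun _ => (Leq L M).Term ((α ⊕ Unit) ⊕ Fin n))
            (fun i => var (Sum.inr i)) (var (Sum.inl (Sum.inr ()))) i)) =
        Fin.snoc (α := fun _ => Meq L M) y x := by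
      intro y
      refine funext (Fin.lastCases ?_ fun i => ?_) <;> simp
    simp only [h₁, h₂]
    constructor
    · rintro ⟨y, hy, hx⟩
      obtain rfl : y = fun i => Meq.real L ((ts i).realize v) := funext hy
      exact (relMap_graph_snoc f _ x).1 hx
    · intro hx
      exact ⟨fun i => Meq.real L ((ts i).realize v), fun _ => rfl, (relMap_graph_snoc f _ x).2 hx⟩

/-- Quantifiers are relativized to the home sort, and terms are replaced by their graphs. -/
theorem exists_boundedFormula_real {α : Type*} {n : ℕ} (φ : L.BoundedFormula α n) :
    ∃ φ' : (Leq L M).BoundedFormula α n, ∀ (v : α → M) (xs : Fin n → M),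
      φ'.Realize (fun i => Meq.real L (v i)) (fun i => Meq.real L (xs i)) ↔ φ.Realize v xs := by
  have real_elim : ∀ {n : ℕ} (v : α → M) (xs : Fin n → M),
      (Sum.elim (fun i => Meq.real L (v i)) (fun i => Meq.real L (xs i)) : α ⊕ Fin n → Meq L M) =
        fun i => Meq.real L (Sum.elim v xs i) := by
    intro n v xs
    ext (i | i) <;> rfl
  induction φ with
  | falsum => exact ⟨⊥, fun v xs => Iff.rfl⟩
  | @equal n t₁ t₂ =>
    obtain ⟨τ₁, h₁⟩ := exists_term_graph (M := M) t₁
    obtain ⟨τ₂, h₂⟩ := exists_term_graph (M := M) t₂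
    obtain ⟨ψ, hψ⟩ := exists_boundedFormula_of_formula (N := Meq L M)
      (Formula.iExs Unit (τ₁ ⊓ τ₂))
    refine ⟨ψ, fun v xs => ?_⟩
    rw [hψ, Formula.realize_iExs, real_elim]
    simp only [Formula.realize_inf]
    constructor
    · rintro ⟨x, hx₁, hx₂⟩
      exact Meq.real_injective (((h₁ _ (x ())).1 hx₁).symm.trans ((h₂ _ (x ())).1 hx₂))
    · intro h
      exact ⟨fun _ => Meq.real L (t₁.realize (Sum.elim v xs)), (h₁ _ _).2 rfl,
        (h₂ _ _).2 (congrArg _ h)⟩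
  | @rel n l R ts =>
    choose τ hτ using fun i => exists_term_graph (M := M) (ts i)
    obtain ⟨ψ, hψ⟩ := exists_boundedFormula_of_formula (N := Meq L M)
      (Formula.iExs (Fin l)
      (Formula.iInf (fun i => (τ i).relabel (Sum.map id fun _ => i)) ⊓
        Relations.formula (L := Leq L M) (Leq.rel R)
          (fun i => var (Sum.inr i))))
    refine ⟨ψ, fun v xs => ?_⟩
    rw [hψ, Formula.realize_iExs, real_elim]
    simp only [Formula.realize_inf, Formula.realize_iInf, Formula.realize_relabel,
      Formula.realize_rel, Term.realize_var, Sum.elim_inr]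
    have h₁ : ∀ (y : Fin l → Meq L M) (i : Fin l),
        (τ i).Realize (Sum.elim (fun i => Meq.real L (Sum.elim v xs i)) y ∘
          Sum.map id fun _ => i) ↔ y i = Meq.real L ((ts i).realize (Sum.elim v xs)) := by
      intro y i
      rw [← hτ]
      apply iff_of_eq
      congr 1
      ext (j | j) <;> rfl
    simp only [h₁]
    constructor
    · rintro ⟨y, hy, hx⟩
      obtain rfl : y = fun i => Meq.real L ((ts i).realize (Sum.elim v xs)) := funext hy
      exact (relMap_rel_real R _).1 hx
    · intro hx
      exact ⟨fun i => Meq.real L ((ts i).realize (Sum.elim v xs)), fun _ => rfl,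
        (relMap_rel_real R _).2 hx⟩
  | imp φ ψ ihφ ihψ =>
    obtain ⟨φ', hφ⟩ := ihφ
    obtain ⟨ψ', hψ⟩ := ihψ
    exact ⟨φ'.imp ψ', fun v xs => imp_congr (hφ v xs) (hψ v xs)⟩
  | @all n φ ih =>
    obtain ⟨φ', hφ⟩ := ih
    refine ⟨((Relations.boundedFormula (L := Leq L M) Leq.home
      fun _ : Fin 1 => var (Sum.inr (Fin.last n))).imp φ').all, fun v xs => ?_⟩
    have snoc_real : ∀ a : M, (Fin.snoc (α := fun _ => Meq L M) (fun i => Meq.real L (xs i))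
        (Meq.real L a)) = fun i => Meq.real L (Fin.snoc (α := fun _ => M) xs a i) := fun a =>
      funext (Fin.lastCases (by simp) fun i => by simp)
    simp only [BoundedFormula.realize_all, BoundedFormula.realize_imp, BoundedFormula.realize_rel,
      relMap_homeSort, Term.realize_var, Sum.elim_inr, Fin.snoc_last]
    constructor
    · intro h a
      rw [← hφ, ← snoc_real]
      exact h _ ⟨a, rfl⟩
    · rintro h _ ⟨a, rfl⟩
      rw [snoc_real, hφ]
      exact h a

theorem exists_formula_real {α : Type*} (φ : L.Formula α) :
    ∃ φ' : (Leq L M).Formula α, ∀ v : α → M,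
      φ'.Realize (fun i => Meq.real L (v i)) ↔ φ.Realize v := by
  obtain ⟨φ', h⟩ := exists_boundedFormula_real (M := M) φ
  refine ⟨φ', fun v => ?_⟩
  rw [← Formula.boundedFormula_realize_eq_realize φ v default, ← h,
    Formula.boundedFormula_realize_eq_realize]

theorem definable₁_cls {α : Type} (a : α → M) {A : Set M} (hA : range a ⊆ A) (E : EqSort L M)
    (θ : L.Formula (α ⊕ Fin E.arity)) :
    (Meq.real L '' A).Definable₁ (Leq L M)
      {x | ∃ y, θ.Realize (Sum.elim a y) ∧ x = Meq.cls E y} := by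
  obtain ⟨θ', hθ⟩ := exists_formula_real (M := M) θ
  have := definable₁_of_formula (L := Leq L M) (fun i => Meq.real L (a i))
    (A := Meq.real L '' A) (by rintro _ ⟨i, rfl⟩; exact ⟨_, hA ⟨i, rfl⟩, rfl⟩)
    (Formula.iExs (Fin E.arity)
      (θ'.relabel (Sum.map Sum.inl id) ⊓ Relations.formula (L := Leq L M) (Leq.proj E)
        (Fin.snoc (α := fun _ => (Leq L M).Term ((α ⊕ Unit) ⊕ Fin E.arity))
            (fun i => var (Sum.inr i)) (var (Sum.inl (Sum.inr ()))))))
  convert this using 1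
  ext x
  simp only [mem_ofPred_eq]
  rw [Formula.realize_iExs]
  simp only [Formula.realize_inf, Formula.realize_relabel, Formula.realize_rel]
  have h₂ : ∀ y : Fin E.arity → Meq L M, (fun i => Term.realize (L := Leq L M)
      (Sum.elim (Sum.elim (fun i => Meq.real L (a i)) fun _ => x) y)
      (Fin.snoc (α := fun _ => (Leq L M).Term ((α ⊕ Unit) ⊕ Fin E.arity))
          (fun i => var (Sum.inr i)) (var (Sum.inl (Sum.inr ()))) i)) =
      Fin.snoc (α := fun _ => Meq L M) y x := by
    intro y
    refine funext (Fin.lastCases ?_ fun i => ?_) <;> simp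
  have h₃ : ∀ y : Fin E.arity → M,
      (Sum.elim (Sum.elim (fun i => Meq.real L (a i)) fun _ => x) (fun i => Meq.real L (y i)) ∘
        (Sum.map Sum.inl id : α ⊕ Fin E.arity → (α ⊕ Unit) ⊕ Fin E.arity)) =
      fun i => Meq.real L (Sum.elim a y i) := by
    intro y
    ext (i | i) <;> rfl
  simp only [h₂, relMap_proj_snoc]
  constructor
  · rintro ⟨y, hy, rfl⟩
    exact ⟨fun i => Meq.real L (y i), by rwa [h₃, hθ], y, rfl, rfl⟩
  · rintro ⟨_, hy, b, rfl, rfl⟩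
    rw [h₃, hθ] at hy
    exact ⟨b, hy, rfl⟩

end Translation

/-! ### The amalgamation argument -/

section Main

variable {L : FirstOrder.Language.{u, v}} {M : Type w} [L.Structure M]

theorem sameType_concat {k m n : ℕ} (h : k + m = n) {a : Fin k → M} {x y : Fin m → M}
    (hxy : SameType L (Sum.elim a x) (Sum.elim a y)) :
    SameType L (concat h a x) (concat h a y) := by
  subst h
  have key : ∀ z : Fin m → M, concat rfl a z = Sum.elim a z ∘ finSumFinEquiv.symm := by
    intro z
    funext i
    change Fin.append a z i = _
    refine Fin.addCases (fun j => ?_) (fun j => ?_) i <;> simp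
  rw [key, key]
  exact hxy.comp _

/-- Under condition `(*)`, an equivalence relation with finitely many classes on the
realizations of a type over a finite tuple `a` disjoint from them is trivial. -/
theorem rel_of_starCondition [Nonempty M] (hacl : DegenerateAcl L M) (hh : Homogeneous L M)
    (hs : Saturated L M) {k m : ℕ} (hm : 0 < m) {a : Fin k → M} {b b' : Fin m → M}
    (hstar : StarCondition L (tp L (concat rfl a b)))
    (hb : ∀ i, b i ∉ range a) (hbb' : SameType L (Sum.elim a b) (Sum.elim a b'))
    (E : EqSort L M) (g : Fin E.arity → Fin k ⊕ Fin m) {D : Set (Meq L M)} (hD : D.Finite)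
    (hDa : ∀ x, SameType L (Sum.elim a b) (Sum.elim a x) → Meq.cls E (Sum.elim a x ∘ g) ∈ D) :
    Meq.cls E (Sum.elim a b ∘ g) = Meq.cls E (Sum.elim a b' ∘ g) := by
  classical
  let P : (Fin m → M) → Prop := fun x => SameType L (Sum.elim a b) (Sum.elim a x)
  let F : (Fin m → M) → Meq L M := fun x => Meq.cls E (Sum.elim a x ∘ g)
  have hdisj : ∀ x, P x → Disjoint (range a) (range x) := by
    intro x hx
    rw [Set.disjoint_left]
    rintro _ ⟨i, rfl⟩ ⟨j, hj⟩
    exact hb j ⟨i, (hx.eq_iff (Sum.inl i) (Sum.inr j)).2 hj.symm⟩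
  have havoid : ∀ B : Finset M, ∃ x, P x ∧ ∀ i, x i ∉ B := by
    intro B
    obtain ⟨x, hx, hB⟩ := hacl.exists_avoiding hh hs (SameType.refl a) b B
    exact ⟨x, hx, fun i => hB i (hb i)⟩
  -- Pigeonhole: otherwise each value would have a finite set met by all its realizations, and a
  -- realization avoiding the union of these sets over `D` would have no possible value.
  obtain ⟨C, hC⟩ : ∃ C, ∀ B : Finset M, ∃ x, P x ∧ F x = C ∧ ∀ i, x i ∉ B := by
    by_contra! hcon
    choose B hB using hcon
    obtain ⟨x, hx, hxB⟩ := havoid (hD.toFinset.biUnion B)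
    obtain ⟨i, hi⟩ := hB (F x) x hx rfl
    exact hxB i (Finset.mem_biUnion.2 ⟨F x, hD.mem_toFinset.2 (hDa x hx), hi⟩)
  by_contra hne
  obtain ⟨d, hd, hdC⟩ : ∃ d, P d ∧ F d ≠ C := by
    by_cases h : F b = C
    · exact ⟨b', hbb', fun h' => hne (h.trans h'.symm)⟩
    · exact ⟨b, SameType.refl _, h⟩
  have hdisj' : ∀ (x y : Fin m → M), (∀ i, x i ∉ Finset.univ.image y) →
      Disjoint (range x) (range y) := by
    intro x y h
    rw [Set.disjoint_left]
    rintro _ ⟨i, rfl⟩ ⟨j, hj⟩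
    exact h i (Finset.mem_image.2 ⟨j, Finset.mem_univ _, hj⟩)
  obtain ⟨x₁, hx₁, hF₁, hB₁⟩ := hC (Finset.univ.image d)
  obtain ⟨x₂, hx₂, hF₂, hB₂⟩ := hC (Finset.univ.image d ∪ Finset.univ.image x₁)
  obtain ⟨x₃, hx₃, hF₃, hB₃⟩ :=
    hC (Finset.univ.image d ∪ (Finset.univ.image x₁ ∪ Finset.univ.image x₂))
  simp only [Finset.mem_union, not_or] at hB₂ hB₃
  have hreal : ∀ x, P x → concat rfl a x ∈ realizations L (tp L (concat rfl a b)) :=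
    fun x hx => tp_eq_iff.2 (sameType_concat rfl hx.symm)
  -- The tuples `x₁, x₂, x₃, d` play the roles of the four starred tuples, in that order: over `x₁`
  -- the new tuple imitates `x₃`, over `x₂` it imitates `d`.
  obtain ⟨e, he₁, he₂⟩ := hstar k m rfl hm a x₁ x₂ x₃ d (by
    simp only [List.pairwise_cons, List.mem_cons, List.not_mem_nil, or_false, forall_eq_or_imp,
      forall_eq, IsEmpty.forall_iff, implies_true, List.Pairwise.nil, and_true]
    exact ⟨⟨hdisj _ hx₁, hdisj _ hx₂, hdisj _ hx₃, hdisj _ hd⟩,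
      ⟨(hdisj' _ _ fun i => (hB₂ i).2).symm, (hdisj' _ _ fun i => (hB₃ i).2.1).symm,
        hdisj' _ _ hB₁⟩,
      ⟨(hdisj' _ _ fun i => (hB₃ i).2.2).symm, hdisj' _ _ fun i => (hB₂ i).1⟩,
      hdisj' _ _ fun i => (hB₃ i).1⟩)
    (hreal _ hx₁) (hreal _ hx₂) (hreal _ hx₃) (hreal _ hd)
  have hF : ∀ x y z : Fin m → M, SameType L (Sum.elim x (Sum.elim z a))
      (Sum.elim y (Sum.elim z a)) → (F x = F z ↔ F y = F z) := by
    intro x y z h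
    have key := h.rel_iff E (Sum.elim (Sum.inr ∘ Sum.inr) Sum.inl ∘ g)
      (Sum.elim (Sum.inr ∘ Sum.inr) (Sum.inr ∘ Sum.inl) ∘ g)
    have e₁ : ∀ x : Fin m → M, Sum.elim x (Sum.elim z a) ∘
        (Sum.elim (Sum.inr ∘ Sum.inr) Sum.inl ∘ g) = Sum.elim a x ∘ g := by
      intro x
      rw [← Function.comp_assoc]
      congr 1
      ext (i | i) <;> rfl
    have e₂ : ∀ x : Fin m → M, Sum.elim x (Sum.elim z a) ∘
        (Sum.elim (Sum.inr ∘ Sum.inr) (Sum.inr ∘ Sum.inl) ∘ g) = Sum.elim a z ∘ g := by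
      intro x
      rw [← Function.comp_assoc]
      congr 1
      ext (i | i) <;> rfl
    rw [e₁, e₁, e₂, e₂] at key
    exact Meq.cls_eq_iff.trans (key.trans Meq.cls_eq_iff.symm)
  have h₁ : F e = F x₁ := (hF _ _ _ (tp_eq_iff.1 he₁)).2 (hF₃.trans hF₁.symm)
  have h₂ : F e = F x₂ := h₁.trans (hF₁.trans hF₂.symm)
  exact hdC (((hF _ _ _ (tp_eq_iff.1 he₂)).1 h₂).trans hF₂)

/-- Entries of `b` that occur in `a` occur at the same places in every realization of the type, so
`g` rebuilds a realization from `a` and its remaining entries, which are disjoint from `a`. -/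
theorem cls_eq_of_sameType [Nonempty M] (hacl : DegenerateAcl L M) (hh : Homogeneous L M)
    (hs : Saturated L M)
    (hstar : ∀ n : ℕ, 0 < n → ∀ p : (L.completeTheory M).CompleteType (Fin n),
      StarCondition L p)
    {k : ℕ} {a : Fin k → M} (E : EqSort L M) {b b' : Fin E.arity → M}
    (hbb' : SameType L (Sum.elim a b) (Sum.elim a b')) {D : Set (Meq L M)} (hD : D.Finite)
    (hDa : ∀ y, SameType L (Sum.elim a b) (Sum.elim a y) → Meq.cls E y ∈ D) :
    Meq.cls E b = Meq.cls E b' := by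
  classical
  obtain ⟨m, ⟨e⟩⟩ := Finite.exists_equiv_fin {j // b j ∉ range a}
  let proper : (Fin E.arity → M) → Fin m → M := fun y i => y (e.symm i)
  let g : Fin E.arity → Fin k ⊕ Fin m := fun j =>
    if h : b j ∈ range a then Sum.inl h.choose else Sum.inr (e ⟨j, h⟩)
  have hg : ∀ y, SameType L (Sum.elim a b) (Sum.elim a y) → Sum.elim a (proper y) ∘ g = y := by
    intro y hy
    funext j
    by_cases h : b j ∈ range a
    · have h1 : a h.choose = b j := h.choose_spec
      have h2 : a h.choose = y j := (hy.eq_iff (Sum.inl _) (Sum.inr j)).1 h1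
      simp only [Function.comp, g, dif_pos h, Sum.elim_inl, h2]
    · simp only [Function.comp, g, dif_neg h, Sum.elim_inr, proper, Equiv.symm_apply_apply]
  have hproper : ∀ y, SameType L (Sum.elim a b) (Sum.elim a y) →
      SameType L (Sum.elim a (proper b)) (Sum.elim a (proper y)) := by
    intro y hy
    convert hy.comp (Sum.map id fun i => (e.symm i : Fin E.arity)) using 1 <;>
      ext (i | i) <;> rfl
  have hrefl : SameType L (Sum.elim a b) (Sum.elim a b) := SameType.refl _
  rw [← hg b hrefl, ← hg b' hbb']
  -- With no remaining entries, `(*)` does not apply, but `b` and `b'` are then the same tuple.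
  rcases Nat.eq_zero_or_pos m with rfl | hm
  · rw [Subsingleton.elim (proper b) (proper b')]
  · refine rel_of_starCondition hacl hh hs hm (hstar _ (by omega) _) (fun i => (e.symm i).2)
      (hproper b' hbb') E g hD fun x hx => hDa _ ?_
    have := hx.comp (Sum.elim Sum.inl g)
    convert this using 1
    · ext (i | i)
      · rfl
      · exact (congrFun (hg b hrefl) i).symm
    · ext (i | i) <;> rfl

/-- In a saturated structure, imaginaries that lie in the same definable sets as `cls E b` over a
finite tuple `a` are represented by realizations of the type of `b` over `a`. -/
theorem exists_sameType_of_forall_mem (hs : Saturated L M) {k : ℕ} (a : Fin k → M)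
    (E : EqSort L M) (b : Fin E.arity → M) (x : Meq L M)
    (hx : ∀ θ : L.Formula (Fin k ⊕ Fin E.arity), θ.Realize (Sum.elim a b) →
      ∃ y, θ.Realize (Sum.elim a y) ∧ x = Meq.cls E y) :
    ∃ y, SameType L (Sum.elim a b) (Sum.elim a y) ∧ x = Meq.cls E y := by
  obtain ⟨y₀, -, rfl⟩ := hx ⊤ (by simp)
  obtain ⟨φ, hφ⟩ := empty_definable_iff.1 E.definable
  -- Each formula of the type is paired with equivalence to the fixed representative `y₀` of `x`, so
  -- that the realization obtained by saturation still represents `x`.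
  let g : L.Formula (Fin k ⊕ Fin E.arity) → L.Formula ((Fin k ⊕ Fin E.arity) ⊕ Fin E.arity) :=
    fun θ => θ.relabel (Sum.map Sum.inl id) ⊓ φ.relabel (Sum.map Sum.inr id)
  have hg : ∀ θ y, (g θ).Realize (Sum.elim (Sum.elim a y₀) y) ↔
      θ.Realize (Sum.elim a y) ∧ E.rel y₀ y := by
    intro θ y
    simp only [g, Formula.realize_inf, Formula.realize_relabel]
    refine and_congr ?_ ?_
    · apply iff_of_eq
      congr 1
      ext (i | i) <;> rfl
    · exact (Set.ext_iff.1 hφ (Sum.elim (Sum.elim a y₀) y ∘ Sum.map Sum.inr id)).symm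
  obtain ⟨y, hy⟩ := hs _ _ (Sum.elim a y₀) (g '' {θ | θ.Realize (Sum.elim a b)}) fun F hF => by
    choose θ hθ hθg using fun ψ : F => hF ψ.2
    obtain ⟨y, hy, hy₀⟩ := hx (Formula.iInf θ) (Formula.realize_iInf.2 hθ)
    refine ⟨y, fun ψ hψ => ?_⟩
    have h : g (θ ⟨ψ, hψ⟩) = ψ := hθg ⟨ψ, hψ⟩
    rw [← h, hg]
    exact ⟨Formula.realize_iInf.1 hy _, Meq.cls_eq_iff.1 hy₀⟩
  refine ⟨y, SameType.of_forall_imp fun θ hθ => ((hg θ y).1 (hy _ ⟨θ, hθ, rfl⟩)).1, ?_⟩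
  rw [Meq.cls_eq_iff]
  exact ((hg ⊤ y).1 (hy _ ⟨⊤, by simp, rfl⟩)).2

theorem dcl_subset_acl (L : FirstOrder.Language.{u, v}) {N : Type w} [L.Structure N]
    (A : Set N) : dcl L A ⊆ acl L A :=
  fun b hb => ⟨{b}, hb, finite_singleton b, rfl⟩

/-- A set of imaginaries definable over real parameters is definable over a finite tuple of them,
and so is invariant under equality of types over that tuple. -/
theorem exists_tuple_of_definable₁ (hh : Homogeneous L M) {A : Set M} {D : Set (Meq L M)}
    (hD : (Meq.real L '' A).Definable₁ (Leq L M) D) :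
    ∃ (k : ℕ) (a : Fin k → M), range a ⊆ A ∧ ∀ (E : EqSort L M) (b y : Fin E.arity → M),
      SameType L (Sum.elim a b) (Sum.elim a y) → Meq.cls E b ∈ D → Meq.cls E y ∈ D := by
  obtain ⟨A₀, hA₀, hD⟩ := definable_iff_finitely_definable.1 hD
  obtain ⟨φ, hφ⟩ := definable_iff_exists_formula_sum.1 hD
  choose a haA ha using fun i : Fin A₀.card => hA₀ (A₀.equivFin.symm i).2
  refine ⟨A₀.card, a, by rintro _ ⟨i, rfl⟩; exact haA i, fun E b y hby hb => ?_⟩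
  have key : ∀ z : Fin E.arity → M, Meq.cls E z ∈ D ↔
      φ.Realize (Sum.elim (fun i : (A₀ : Set (Meq L M)) => (i : Meq L M))
        fun _ => Meq.cls E z) := fun z =>
    Set.ext_iff.1 hφ fun _ => Meq.cls E z
  rw [key] at hb ⊢
  refine (EqSame.formula_realize_iff hh ⟨_, inferInstance, _, _, hby, ?_⟩ φ).1 hb
  rintro (i | i)
  · refine ⟨homeSort L M, fun _ => Sum.inl (A₀.equivFin i), ?_⟩
    have : (i : Meq L M) = Meq.real L (a (A₀.equivFin i)) := by
      refine Eq.trans ?_ (ha _).symm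
      exact congrArg Subtype.val (A₀.equivFin.symm_apply_apply i).symm
    exact ⟨this, this⟩
  · exact ⟨E, Sum.inr, rfl, rfl⟩

end Main

end ImaginaryClosure

theorem corollary6p2 (L : FirstOrder.Language.{u, v}) [Countable L.Symbols]
    (M : Type w) [L.Structure M] [Nonempty M]
    (hcat : ImaginaryClosure.OmegaCategorical L M)
    (hacl : ImaginaryClosure.DegenerateAcl L M)
    (hstar : ∀ n : ℕ, 0 < n → ∀ p : (L.completeTheory M).CompleteType (Fin n),
      ImaginaryClosure.StarCondition L p)
    (A : Set M) :
    ImaginaryClosure.acl (ImaginaryClosure.Leq L M) (ImaginaryClosure.Meq.real L '' A) =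
      ImaginaryClosure.dcl (ImaginaryClosure.Leq L M) (ImaginaryClosure.Meq.real L '' A) := by
  open ImaginaryClosure in
  refine Subset.antisymm ?_ (dcl_subset_acl _ _)
  rintro x ⟨D, hD, hfin, hx⟩
  have : Infinite M := hacl.infinite
  have hh := hcat.homogeneous
  have hs := hcat.saturated
  obtain ⟨k, a, haA, hDa⟩ := exists_tuple_of_definable₁ hh hD
  obtain ⟨E, b, rfl⟩ := x.exists_eq_cls
  -- If no set separates `x'` from `cls E b`, then `x'` lies in every set of classes defined by a
  -- formula of `tp(b/a)`, so it is the class of a realization of that type.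
  have hsep : ∀ x' : D, ∃ S : Set (Meq L M), (Meq.real L '' A).Definable₁ (Leq L M) S ∧
      Meq.cls E b ∈ S ∧ ((x' : Meq L M) ∈ S → (x' : Meq L M) = Meq.cls E b) := by
    intro x'
    by_contra! hcon
    obtain ⟨y, hy, hxy⟩ := exists_sameType_of_forall_mem hs a E b x' fun θ hθ =>
      (hcon _ (definable₁_cls a haA E θ) ⟨b, hθ, rfl⟩).1
    refine (hcon univ definable_univ (mem_univ _)).2 ?_
    rw [hxy]
    exact (cls_eq_of_sameType hacl hh hs hstar E hy hfin fun z hz => hDa E b z hz hx).symm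
  choose S hS hbS hSx using hsep
  have : Finite D := hfin
  have hdef := Definable.inter hD (definable_iInter_of_finite hS)
  change (Meq.real L '' A).Definable₁ (Leq L M) {Meq.cls E b}
  unfold Definable₁
  convert hdef using 1
  ext z
  simp only [mem_inter_iff, mem_iInter, mem_ofPred_eq, mem_singleton_iff]
  exact ⟨fun h => by rw [h]; exact ⟨hx, hbS⟩, fun h => hSx ⟨_, h.1⟩ (h.2 ⟨_, h.1⟩)⟩
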